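/- **Setting.** For a pure state $|\phi\rangle$ of $N$ qubits put $d=2^N$ and $p_P=\frac1d|\langle\phi|P|\phi\rangle|^2$ for each of the $4^N$ Pauli strings $P\in\{I,X,Y,Z\}^{\otimes N}$. The stabilizer 2-Rényi entropy of $|\phi\rangle$ is $$\mathcal M_2(|\phi\rangle)=-\log\Big(\sum_P p_P^2\Big)-\log d .$$ Let $A$ and $B$ consist of $n_A$ and $n_B$ qubits and let $|\psi\rangle_{AB}$ be a unit vector. The non-local stabilizer 2-Rényi entropy is $$\mathcal M_2^{NL}(|\psi\rangle_{AB})=\min_{U_A,U_B}\mathcal M_2\big((U_A\otimes U_B)|\psi\rangle_{AB}\big),$$ where $U_A,U_B$ run over all unitaries on $A$ and on $B$. Let $\rho_A=\mathrm{Tr}_B|\psi\rangle\langle\psi|$, let $S_\alpha(A)=\frac1{1-\alpha}\log\mathrm{Tr}\,\rho_A^\alpha$ and $S_{\max}(A)=\log\operatorname{rank}\rho_A$. Let $n\ge 0$ be an integer with $\operatorname{rank}\rho_A\le 2^n$ and let $\lambda_0\ge\lambda_1\ge\dots\ge\lambda_{2^n-1}\ge 0$ be the nonzero eigenvalues of $\rho_A$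 in descending order, followed by zeros. Let $C$ be an $n$-qubit Clifford unitary and $|s_i\rangle=C|i\rangle$ for $0\le i<2^n$, where $|i\rangle$ is the computational basis vector labelled by the binary digits of $i$. Thus the $|s_i\rangle$ are the joint eigenvectors of the stabilizer group generated by the operators $C Z_k C^\dagger$. The spectral estimate is $$\mathcal M_2(\{\lambda_i\})=\mathcal M_2\Big(\sum_{i=0}^{2^n-1}\sqrt{\lambda_i}\,|s_i\rangle|s_i\rangle\Big).$$ **Statement.** The minimum defining $\mathcal M_2^{NL}$ is attained, and for every choice of $C$ $$\mathcal M_2^{NL}(|\psi\rangle_{AB})\le\mathcal M_2(\{\lambda_i\})\le\min\big\{2S_2(A),\;4\,(n\log 2-S_{1/2}(A))\big\}.$$ In particular, if the Schmidt rank $\operatorname{rank}\rho_A$ equals $2^n$, so that $S_{\max}(A)=n\log 2$, then $$\mathcal M_2^{NL}(|\psi\rangle_{AB})\le\mathcal M_2(\{\lambda_i\})\le\min\big\{2S_2(A),\;4\,(S_{\max}(A)-S_{1/2}(A))\big\}.$$ -/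

import Mathlib

open scoped Matrix

noncomputable section

namespace NonlocalMagic

/-- Computational basis labels of a register of qubits labelled by `ι`. -/
abbrev Bits (ι : Type) : Type := ι → Fin 2

/-- The Hilbert space `(ℂ²)^{⊗ ι}` of a register of qubits labelled by `ι`, written in the
computational basis. -/
abbrev QState (ι : Type) : Type := EuclideanSpace ℂ (Bits ι)

/-- The one-qubit Pauli matrices `I, X, Y, Z`. -/
def pauli : Fin 4 → Matrix (Fin 2) (Fin 2) ℂ :=
  ![!![1, 0; 0, 1], !![0, 1; 1, 0], !![0, -Complex.I; Complex.I, 0], !![1, 0; 0, -1]]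

/-- The Pauli string `⨂ₖ σ_{p k}`. As `p` varies these are the `4^|ι|` Pauli strings modulo
phases. -/
def pauliString {ι : Type} [Fintype ι] (p : ι → Fin 4) : Matrix (Bits ι) (Bits ι) ℂ :=
  Matrix.of fun x y => ∏ k, pauli (p k) (x k) (y k)

/-- The expectation value `⟨ψ|P|ψ⟩`. -/
def expectation {ι : Type} [Fintype ι] [DecidableEq ι]
    (P : Matrix (Bits ι) (Bits ι) ℂ) (ψ : QState ι) : ℂ :=
  star ψ.ofLp ⬝ᵥ (P *ᵥ ψ.ofLp)

/-- The weight `|⟨ψ|P|ψ⟩|² / d`, `d = 2^|ι|`, of the Pauli string `P`. -/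
def pauliProb {ι : Type} [Fintype ι] [DecidableEq ι]
    (ψ : QState ι) (p : ι → Fin 4) : ℝ :=
  ‖expectation (pauliString p) ψ‖ ^ 2 / 2 ^ Fintype.card ι

/-- The stabilizer 2-Rényi entropy `- log (∑_P p_P ^ 2) - log d`, `d = 2^|ι|`, of a pure state. -/
def stabRenyi {ι : Type} [Fintype ι] [DecidableEq ι] (ψ : QState ι) : ℝ :=
  -Real.log (∑ p : ι → Fin 4, pauliProb ψ p ^ 2) - Real.log (2 ^ Fintype.card ι)

/-- The operator `U ⊗ V` on the joint register. -/
def tensorOp {α β : Type} (U : Matrix (Bits α) (Bits α) ℂ) (V : Matrix (Bits β) (Bits β) ℂ) :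
    Matrix (Bits (α ⊕ β)) (Bits (α ⊕ β)) ℂ :=
  Matrix.of fun x y => U (x ∘ Sum.inl) (y ∘ Sum.inl) * V (x ∘ Sum.inr) (y ∘ Sum.inr)

/-- The state `(U ⊗ V)|ψ⟩`. -/
def localAct {α β : Type} [Fintype α] [Fintype β] [DecidableEq α] [DecidableEq β]
    (U : Matrix.unitaryGroup (Bits α) ℂ) (V : Matrix.unitaryGroup (Bits β) ℂ)
    (ψ : QState (α ⊕ β)) : QState (α ⊕ β) :=
  WithLp.toLp 2 (tensorOp (U : Matrix (Bits α) (Bits α) ℂ) (V : Matrix (Bits β) (Bits β) ℂ)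
    *ᵥ ψ.ofLp)

/-- The values of the stabilizer 2-Rényi entropy on the orbit of `ψ` under the local unitaries
`U_A ⊗ U_B`. -/
def localOrbitValues {α β : Type} [Fintype α] [Fintype β] [DecidableEq α] [DecidableEq β]
    (ψ : QState (α ⊕ β)) : Set ℝ :=
  {m | ∃ (U : Matrix.unitaryGroup (Bits α) ℂ) (V : Matrix.unitaryGroup (Bits β) ℂ),
    m = stabRenyi (localAct U V ψ)}

/-- The non-local stabilizer 2-Rényi entropy: the minimum of the stabilizer 2-Rényi entropy over
all local unitaries. -/
def nonlocalStabRenyi {α β : Type} [Fintype α] [Fintype β] [DecidableEq α] [DecidableEq β]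
    (ψ : QState (α ⊕ β)) : ℝ :=
  sInf (localOrbitValues ψ)

/-- The reduced density matrix `ρ_A = Tr_B |ψ⟩⟨ψ|`. -/
def reducedA {α β : Type} [Fintype β] [DecidableEq β] (ψ : QState (α ⊕ β)) :
    Matrix (Bits α) (Bits α) ℂ :=
  Matrix.of fun a a' => ∑ b : Bits β, ψ (Sum.elim a b) * star (ψ (Sum.elim a' b))

theorem reducedA_isHermitian {α β : Type} [Fintype β] [DecidableEq β] (ψ : QState (α ⊕ β)) :
    (reducedA ψ).IsHermitian := by
  ext a a'
  simp [reducedA, Matrix.conjTranspose_apply, mul_comm]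

/-- The Rényi entropy `S_s(A) = (1 - s)⁻¹ log Tr ρ_A ^ s` of order `s`, for `s > 0`, `s ≠ 1`. -/
def renyiA {α β : Type} [Fintype α] [Fintype β] [DecidableEq α] [DecidableEq β]
    (s : ℝ) (ψ : QState (α ⊕ β)) : ℝ :=
  (1 - s)⁻¹ * Real.log (∑ a, (reducedA_isHermitian ψ).eigenvalues a ^ s)

/-- The Schmidt rank of `ψ` across `A | B`. -/
def schmidtRank {α β : Type} [Fintype α] [Fintype β] [DecidableEq α] [DecidableEq β]
    (ψ : QState (α ⊕ β)) : ℕ :=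
  (reducedA ψ).rank

/-- The max-entropy `S_max(A) = log rank ρ_A`. -/
def maxEntropyA {α β : Type} [Fintype α] [Fintype β] [DecidableEq α] [DecidableEq β]
    (ψ : QState (α ⊕ β)) : ℝ :=
  Real.log (schmidtRank ψ)

/-- The entanglement spectrum as a list `λ_0 ≥ λ_1 ≥ ⋯ ≥ λ_{2^n-1}`: the eigenvalues of `ρ_A` in
descending order, continued by zeros if `2^n` exceeds the dimension of `A`. It contains all nonzero
eigenvalues as soon as `schmidtRank ψ ≤ 2^n`. -/
def schmidtSpectrum {α β : Type} [Fintype α] [Fintype β] [DecidableEq α] [DecidableEq β]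
    (n : ℕ) (ψ : QState (α ⊕ β)) (i : Fin (2 ^ n)) : ℝ :=
  if h : (i : ℕ) < Fintype.card (Bits α) then
    (reducedA_isHermitian ψ).eigenvalues₀ ⟨i, h⟩
  else 0

/-- Clifford unitaries: conjugation maps Pauli strings to Pauli strings up to a phase. -/
def IsClifford {ι : Type} [Fintype ι] [DecidableEq ι]
    (C : Matrix.unitaryGroup (Bits ι) ℂ) : Prop :=
  ∀ p : ι → Fin 4, ∃ (q : ι → Fin 4) (c : ℂ),
    (C : Matrix (Bits ι) (Bits ι) ℂ) * pauliString p * (C : Matrix (Bits ι) (Bits ι) ℂ)ᴴ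
      = c • pauliString q

/-- The vector `|s_i⟩ = C|i⟩`, where `|i⟩` is the computational basis vector labelled by the binary
digits of `i`. For a Clifford unitary `C` these are the joint eigenvectors of the stabilizer group
generated by `S_k = C Z_k C†`, with eigenvalues `(-1)^{i_k}`. -/
def stabilizerBasis {n : ℕ} (C : Matrix.unitaryGroup (Bits (Fin n)) ℂ) (i : Fin (2 ^ n)) :
    QState (Fin n) :=
  WithLp.toLp 2 fun x =>
    (C : Matrix (Bits (Fin n)) (Bits (Fin n)) ℂ) x (finFunctionFinEquiv.symm i)

/-- The state `∑_i √λ_i |s_i⟩|s_i⟩` of `2n` qubits. -/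
def estimateState {n : ℕ} (C : Matrix.unitaryGroup (Bits (Fin n)) ℂ) (lam : Fin (2 ^ n) → ℝ) :
    QState (Fin n ⊕ Fin n) :=
  WithLp.toLp 2 fun x => ∑ i, (Real.sqrt (lam i) : ℂ) *
    (stabilizerBasis C i (x ∘ Sum.inl) * stabilizerBasis C i (x ∘ Sum.inr))

/-- The spectral estimate `𝓜₂({λ_i})`, formed in the stabilizer basis given by `C`. -/
def spectralEstimate {n : ℕ} (C : Matrix.unitaryGroup (Bits (Fin n)) ℂ)
    (lam : Fin (2 ^ n) → ℝ) : ℝ :=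
  stabRenyi (estimateState C lam)

end NonlocalMagic

end

/-!
Write `d = 2^|ι|` for a register `ι` and `Σ(φ) = ∑_P |⟨φ|P|φ⟩|⁴` for the sum over its Pauli strings
(`pauliMoment`). For `φ ≠ 0` the stabilizer entropy is `-log (Σ(φ) / d)` (`stabRenyi_eq`), so upper
bounds on the entropy are lower bounds on `Σ`.

*Attainment.* `Σ` is positive on nonzero vectors, so the entropy is continuous on the local orbit,
which is the image of a product of two compact unitary groups (`isLeast_nonlocalStabRenyi`).

*Comparison with the spectral estimate.* A Clifford unitary permutes the Pauli strings up to phases,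
and `C ⊗ C` is Clifford, so the spectral estimate equals its value for `C = 1`, the entropy of the
diagonal state `∑_j √λ_j |j⟩|j⟩` on `n + n` qubits (`spectralEstimate_eq`). By the Schmidt
decomposition `ψ` is locally equivalent to the same diagonal state on `nA + nB` qubits
(`exists_localAct_eq_diagState`). The eigenvalues are in descending order and at most
`rank ρ_A ≤ 2^m` of them are nonzero, where `m = min n nA nB`. Hence only labels below `2^m` occur
and both states are the diagonal state on `m + m` qubits together with ancillas in the state `|0⟩`,
which do not change the entropy (`stabRenyi_diagState`).

*The two bounds.* Both come from discarding part of the sum `Σ`.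
* The `d` strings of `I` and `Z` have as expectation values the character sums of the distribution
  `|φ x|²`. Their squares add up to `d ∑_x |φ x|⁴` by orthogonality of characters, so by the
  Cauchy–Schwarz inequality `Σ ≥ d (∑_x |φ x|⁴)²` (`le_pauliMoment_of_computational`). For the
  diagonal state `∑_x |φ x|⁴ = ∑ λ_j²`, which gives `2 S_2`.
* By completeness, `∑_P P ⊗ P̄ = 2^n |Ω⟩⟨Ω|` with `|Ω⟩ = ∑_a |a⟩|a⟩`, and `P̄ = ± P`. The
  triangle inequality and the power mean inequality bound `Σ` from below by a multiple of the eighth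
  power of the overlap `|∑_a φ(a, a)|` (`le_pauliMoment_of_maximallyEntangled`). For the diagonal
  state this overlap is `∑ √λ_j`, which gives `4 (n log 2 - S_{1/2})`.
-/

namespace NonlocalMagic

/-! ### Pauli strings and the fourth moment -/

section Pauli

variable {ι : Type} [Fintype ι]

theorem pauli_trace (i j : Fin 4) :
    ∑ a, ∑ b, pauli i a b * star (pauli j a b) = if i = j then 2 else 0 := by
  fin_cases i <;> fin_cases j <;> simp [pauli, Fin.sum_univ_two] <;> norm_num

theorem pauli_completeness (a b a' b' : Fin 2) :
    ∑ i, pauli i a b * star (pauli i a' b') = if a = a' ∧ b = b' then 2 else 0 := by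
  fin_cases a <;> fin_cases b <;> fin_cases a' <;> fin_cases b' <;>
    simp [pauli, Fin.sum_univ_four] <;> norm_num

theorem pauliString_apply (p : ι → Fin 4) (x y : Bits ι) :
    pauliString p x y = ∏ k, pauli (p k) (x k) (y k) := rfl

theorem prod_ite_eq_two_pow (P : ι → Prop) [DecidablePred P] [Decidable (∀ k, P k)] :
    ∏ k, (if P k then (2 : ℂ) else 0) = if ∀ k, P k then 2 ^ Fintype.card ι else 0 := by
  split_ifs with h
  · simp [h, Finset.card_univ]
  · push Not at h
    obtain ⟨k, hk⟩ := h
    exact Finset.prod_eq_zero (Finset.mem_univ k) (if_neg hk)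

/-- The entries of a Pauli string are all real or all imaginary, depending on the number of factors
`Y`, so complex conjugation multiplies the string by a sign. -/
theorem exists_star_pauliString (p : ι → Fin 4) :
    ∃ c : ℂ, ‖c‖ = 1 ∧ ∀ x y, star (pauliString p x y) = c * pauliString p x y := by
  let s : Fin 4 → ℂ := ![1, 1, -1, 1]
  refine ⟨∏ k, s (p k), ?_, fun x y => ?_⟩
  · rw [norm_prod]
    refine Finset.prod_eq_one fun k _ => ?_
    generalize p k = i
    fin_cases i <;> simp [s]
  · rw [pauliString_apply, star_prod, ← Finset.prod_mul_distrib]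
    refine Finset.prod_congr rfl fun k _ => ?_
    generalize p k = i, x k = a, y k = b
    fin_cases i <;> fin_cases a <;> fin_cases b <;> simp [s, pauli]

variable [DecidableEq ι]

/-- Orthogonality of the Pauli strings for the Hilbert–Schmidt inner product. -/
theorem pauliString_trace (p q : ι → Fin 4) :
    ∑ x, ∑ y, pauliString p x y * star (pauliString q x y)
      = if p = q then 2 ^ Fintype.card ι else 0 := by
  have h : ∑ x : Bits ι, ∑ y : Bits ι, pauliString p x y * star (pauliString q x y)
      = ∏ k, ∑ a, ∑ b, pauli (p k) a b * star (pauli (q k) a b) := by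
    rw [Fintype.prod_sum]
    refine Finset.sum_congr rfl fun x _ => ?_
    rw [Fintype.prod_sum]
    refine Finset.sum_congr rfl fun y _ => ?_
    simp only [pauliString_apply, star_prod, Finset.prod_mul_distrib]
  simp only [h, pauli_trace, funext_iff, prod_ite_eq_two_pow]

/-- Completeness of the Pauli strings: `∑_P P ⊗ P̄` is `2^|ι|` times the unnormalised projection
`|Ω⟩⟨Ω|`, `|Ω⟩ = ∑_x |x⟩|x⟩`. -/
theorem pauliString_completeness (x y x' y' : Bits ι) :
    ∑ p : ι → Fin 4, pauliString p x y * star (pauliString p x' y')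
      = if x = x' ∧ y = y' then 2 ^ Fintype.card ι else 0 := by
  have h : ∑ p : ι → Fin 4, pauliString p x y * star (pauliString p x' y')
      = ∏ k, ∑ i, pauli i (x k) (y k) * star (pauli i (x' k) (y' k)) := by
    rw [Fintype.prod_sum]
    refine Finset.sum_congr rfl fun y _ => ?_
    simp only [pauliString_apply, star_prod, Finset.prod_mul_distrib]
  simp only [h, pauli_completeness, funext_iff, prod_ite_eq_two_pow, ← forall_and]

theorem pauli_mul_self (i : Fin 4) (a c : Fin 2) :
    ∑ b, pauli i a b * pauli i b c = if a = c then 1 else 0 := by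
  fin_cases i <;> fin_cases a <;> fin_cases c <;> simp [pauli, Fin.sum_univ_two]

theorem pauliString_mul_self (p : ι → Fin 4) : pauliString p * pauliString p = 1 := by
  ext x z
  have h : (pauliString p * pauliString p) x z
      = ∏ k, ∑ b, pauli (p k) (x k) b * pauli (p k) b (z k) := by
    rw [Matrix.mul_apply, Fintype.prod_sum]
    refine Finset.sum_congr rfl fun y _ => ?_
    simp only [pauliString_apply, Finset.prod_mul_distrib]
  rw [h, Matrix.one_apply]
  simp only [pauli_mul_self]
  split_ifs with hxz
  · simp [hxz]
  · obtain ⟨k, hk⟩ := Function.ne_iff.mp hxz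
    exact Finset.prod_eq_zero (Finset.mem_univ k) (if_neg hk)

/-- Distinct Pauli strings are not proportional. -/
theorem eq_of_pauliString_eq_smul {p q : ι → Fin 4} {c : ℂ}
    (h : pauliString p = c • pauliString q) : p = q := by
  by_contra hpq
  have h1 := pauliString_trace p p
  have h2 := pauliString_trace q p
  rw [if_neg (Ne.symm hpq)] at h2
  rw [if_pos rfl] at h1
  have h3 : ∑ x, ∑ y, pauliString p x y * star (pauliString p x y)
      = c * ∑ x, ∑ y, pauliString q x y * star (pauliString p x y) := by
    simp only [Finset.mul_sum]
    refine Finset.sum_congr rfl fun x _ => Finset.sum_congr rfl fun y _ => ?_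
    nth_rewrite 1 [h]
    simp [mul_assoc]
  rw [h1, h2, mul_zero] at h3
  exact pow_ne_zero _ two_ne_zero h3

theorem expectation_eq_sum (P : Matrix (Bits ι) (Bits ι) ℂ) (ψ : QState ι) :
    expectation P ψ = ∑ x, ∑ y, star (ψ x) * (P x y * ψ y) := by
  simp [expectation, dotProduct, Matrix.mulVec, Finset.mul_sum]

/-- The sum `∑_P |⟨ψ|P|ψ⟩|⁴` over all Pauli strings. -/
noncomputable def pauliMoment (ψ : QState ι) : ℝ :=
  ∑ p : ι → Fin 4, ‖expectation (pauliString p) ψ‖ ^ 4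

theorem sum_pauliProb_sq (ψ : QState ι) :
    ∑ p : ι → Fin 4, pauliProb ψ p ^ 2 = pauliMoment ψ / (2 ^ Fintype.card ι) ^ 2 := by
  simp only [pauliMoment, pauliProb, Finset.sum_div, div_pow, ← pow_mul]

theorem stabRenyi_congr {ψ φ : QState ι} (h : pauliMoment ψ = pauliMoment φ) :
    stabRenyi ψ = stabRenyi φ := by
  simp only [stabRenyi, sum_pauliProb_sq, h]

/-- Restricting the sum over Pauli strings to the strings of `I` and `Z` bounds the moment from
below by the collision probability of the computational basis distribution. -/
theorem le_pauliMoment_of_computational (ψ : QState ι) :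
    2 ^ Fintype.card ι * (∑ x, ‖ψ x‖ ^ 4) ^ 2 ≤ pauliMoment ψ := by
  -- `zed 0 = I` and `zed 1 = Z`, with diagonal entries `χ u a = (-1)^(u a)`
  let zed : Fin 2 → Fin 4 := ![0, 3]
  let χ : Fin 2 → Fin 2 → ℝ := ![![1, 1], ![1, -1]]
  have hpauli : ∀ u a b, pauli (zed u) a b = if a = b then (χ u a : ℂ) else 0 := by
    intro u a b
    fin_cases u <;> fin_cases a <;> fin_cases b <;> simp [zed, χ, pauli]
  have hχ : ∀ a b, ∑ u, χ u a * χ u b = if a = b then 2 else 0 := by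
    intro a b
    fin_cases a <;> fin_cases b <;> simp [χ, Fin.sum_univ_two] <;> norm_num
  let E : Bits ι → ℝ := fun w => ∑ x, ‖ψ x‖ ^ 2 * ∏ k, χ (w k) (x k)
  have hE : ∀ w : Bits ι, expectation (pauliString fun k => zed (w k)) ψ = (E w : ℂ) := by
    intro w
    rw [expectation_eq_sum]
    simp only [E, Complex.ofReal_sum]
    refine Finset.sum_congr rfl fun x _ => ?_
    rw [Finset.sum_eq_single x]
    · have : ((‖ψ x‖ ^ 2 : ℝ) : ℂ) = star (ψ x) * ψ x := by
        rw [Complex.ofReal_pow]; exact (Complex.conj_mul' (ψ x)).symm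
      rw [Complex.ofReal_mul, this, pauliString_apply]
      simp only [hpauli, if_true, Complex.ofReal_prod]
      ring
    · intro y _ hy
      obtain ⟨k, hk⟩ := Function.ne_iff.mp hy
      rw [pauliString_apply, Finset.prod_eq_zero (Finset.mem_univ k)]
      · simp
      · rw [hpauli, if_neg (Ne.symm hk)]
    · simp
  have hsq : ∑ w, E w ^ 2 = 2 ^ Fintype.card ι * ∑ x, ‖ψ x‖ ^ 4 := by
    have h1 : ∀ w, E w ^ 2 = ∑ x, ∑ y, ‖ψ x‖ ^ 2 * ‖ψ y‖ ^ 2 *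
        ∏ k, χ (w k) (x k) * χ (w k) (y k) := by
      intro w
      rw [sq, Finset.sum_mul_sum]
      refine Finset.sum_congr rfl fun x _ => Finset.sum_congr rfl fun y _ => ?_
      rw [Finset.prod_mul_distrib]; ring
    simp only [h1]
    rw [Finset.sum_comm, Finset.mul_sum]
    refine Finset.sum_congr rfl fun x _ => ?_
    rw [Finset.sum_comm]
    simp only [← Finset.mul_sum]
    -- orthogonality of the characters of `(ℤ/2)^ι`
    have h2 : ∀ y : Bits ι, ∑ w : Bits ι, ∏ k, χ (w k) (x k) * χ (w k) (y k)
        = if y = x then 2 ^ Fintype.card ι else 0 := by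
      intro y
      rw [← Fintype.prod_sum fun k u => χ u (x k) * χ u (y k)]
      simp only [hχ]
      split_ifs with h
      · subst h; simp [Finset.card_univ]
      · obtain ⟨k, hk⟩ := Function.ne_iff.mp h
        exact Finset.prod_eq_zero (Finset.mem_univ k) (if_neg (Ne.symm hk))
    simp only [h2, mul_ite, mul_zero, Finset.sum_ite_eq', Finset.mem_univ, if_true]
    ring
  have hcs := sq_sum_le_card_mul_sum_sq (s := Finset.univ) (f := fun w => E w ^ 2)
  rw [hsq] at hcs
  have hcard : ((Finset.univ : Finset (Bits ι)).card : ℝ) = 2 ^ Fintype.card ι := by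
    simp [Finset.card_univ]
  rw [hcard] at hcs
  have hinj : Function.Injective fun (w : Bits ι) (k : ι) => zed (w k) := by
    intro w w' h
    funext k
    have hk := congrFun h k
    have hz : Function.Injective zed := by decide
    exact hz hk
  have hle : ∑ w, (E w ^ 2) ^ 2 ≤ pauliMoment ψ := by
    calc ∑ w, (E w ^ 2) ^ 2
        = ∑ w : Bits ι, ‖expectation (pauliString fun k => zed (w k)) ψ‖ ^ 4 := by
          refine Finset.sum_congr rfl fun w _ => ?_
          rw [hE, Complex.norm_real, Real.norm_eq_abs, ← pow_mul]
          exact (Even.pow_abs (by decide) _).symm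
      _ = ∑ p ∈ Finset.univ.image fun (w : Bits ι) (k : ι) => zed (w k),
            ‖expectation (pauliString p) ψ‖ ^ 4 :=
          (Finset.sum_image (f := fun p => ‖expectation (pauliString p) ψ‖ ^ 4) hinj.injOn).symm
      _ ≤ pauliMoment ψ :=
          Finset.sum_le_sum_of_subset_of_nonneg (Finset.subset_univ _) fun _ _ _ => by positivity
  have hd : (0 : ℝ) < 2 ^ Fintype.card ι := by positivity
  have h3 : 2 ^ Fintype.card ι * (2 ^ Fintype.card ι * (∑ x, ‖ψ x‖ ^ 4) ^ 2)
      ≤ 2 ^ Fintype.card ι * pauliMoment ψ := by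
    calc _ = (2 ^ Fintype.card ι * ∑ x, ‖ψ x‖ ^ 4) ^ 2 := by ring
      _ ≤ _ := hcs
      _ ≤ _ := by gcongr
  exact le_of_mul_le_mul_left h3 hd

theorem sum_norm_pow_four_pos {ψ : QState ι} (hψ : ψ ≠ 0) : 0 < ∑ x, ‖ψ x‖ ^ 4 := by
  obtain ⟨x, hx⟩ : ∃ x, ψ x ≠ 0 := by
    by_contra! h
    exact hψ (PiLp.ext h)
  exact Finset.sum_pos' (fun _ _ => by positivity)
    ⟨x, Finset.mem_univ x, pow_pos (norm_pos_iff.mpr hx) 4⟩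

theorem pauliMoment_pos {ψ : QState ι} (hψ : ψ ≠ 0) : 0 < pauliMoment ψ :=
  lt_of_lt_of_le (mul_pos (by positivity) (pow_pos (sum_norm_pow_four_pos hψ) 2))
    (le_pauliMoment_of_computational ψ)

theorem stabRenyi_eq {ψ : QState ι} (hψ : ψ ≠ 0) :
    stabRenyi ψ = -Real.log (pauliMoment ψ / 2 ^ Fintype.card ι) := by
  have hm := (pauliMoment_pos hψ).ne'
  have hd : (2 ^ Fintype.card ι : ℝ) ≠ 0 := by positivity
  rw [stabRenyi, sum_pauliProb_sq, Real.log_div hm (pow_ne_zero 2 hd), Real.log_div hm hd,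
    Real.log_pow]
  push_cast
  ring

end Pauli

/-! ### Clifford invariance -/

section Unitary

variable {ι : Type} [Fintype ι] [DecidableEq ι]

/-- The state `U|ψ⟩`. -/
noncomputable def act (U : Matrix.unitaryGroup (Bits ι) ℂ) (ψ : QState ι) : QState ι :=
  WithLp.toLp 2 ((U : Matrix (Bits ι) (Bits ι) ℂ) *ᵥ ψ.ofLp)

theorem act_ne_zero (U : Matrix.unitaryGroup (Bits ι) ℂ) {ψ : QState ι} (hψ : ψ ≠ 0) :
    act U ψ ≠ 0 := by
  intro h
  have h1 : (U : Matrix (Bits ι) (Bits ι) ℂ) *ᵥ ψ.ofLp = 0 := congrArg WithLp.ofLp h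
  have h2 := congrArg (fun v => (star (U : Matrix (Bits ι) (Bits ι) ℂ)) *ᵥ v) h1
  simp only [Matrix.mulVec_mulVec, Matrix.UnitaryGroup.star_mul_self, Matrix.one_mulVec,
    Matrix.mulVec_zero] at h2
  exact hψ (PiLp.ext fun x => congrFun h2 x)

theorem expectation_conj (U : Matrix.unitaryGroup (Bits ι) ℂ) (P : Matrix (Bits ι) (Bits ι) ℂ)
    (ψ : QState ι) :
    expectation ((U : Matrix (Bits ι) (Bits ι) ℂ) * P * (U : Matrix (Bits ι) (Bits ι) ℂ)ᴴ)
      (act U ψ) = expectation P ψ := by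
  have hU : (U : Matrix (Bits ι) (Bits ι) ℂ)ᴴ * (U : Matrix (Bits ι) (Bits ι) ℂ) = 1 :=
    Matrix.UnitaryGroup.star_mul_self U
  simp only [expectation, act, Matrix.star_mulVec, ← Matrix.dotProduct_mulVec,
    Matrix.mulVec_mulVec, Matrix.mul_assoc, hU, Matrix.mul_one]
  rw [← Matrix.mul_assoc, hU, Matrix.one_mul]

/-- A Clifford unitary permutes the Pauli strings up to phases, so it leaves the moment
`∑_P |⟨P⟩|⁴` invariant. -/
theorem IsClifford.pauliMoment_act {C : Matrix.unitaryGroup (Bits ι) ℂ} (hC : IsClifford C)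
    (ψ : QState ι) : pauliMoment (act C ψ) = pauliMoment ψ := by
  choose q c h using hC
  set M : Matrix (Bits ι) (Bits ι) ℂ := (C : Matrix (Bits ι) (Bits ι) ℂ)
  have hU : Mᴴ * M = 1 := Matrix.UnitaryGroup.star_mul_self C
  have hU' : M * Mᴴ = 1 := mul_eq_one_comm.mp hU
  -- Pauli strings are involutions, which forces the phases to be signs
  have hc : ∀ p, c p ^ 2 = 1 := by
    intro p
    have h1 : (M * pauliString p * Mᴴ) * (M * pauliString p * Mᴴ) = 1 := by
      calc _ = M * (pauliString p * (Mᴴ * M) * pauliString p) * Mᴴ := by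
            simp only [Matrix.mul_assoc]
        _ = 1 := by rw [hU, Matrix.mul_one, pauliString_mul_self, Matrix.mul_one, hU']
    rw [h p, Matrix.smul_mul, Matrix.mul_smul, pauliString_mul_self, smul_smul] at h1
    have h2 := congrFun (congrFun h1 0) 0
    simpa [sq] using h2
  have hnorm : ∀ p, ‖c p‖ = 1 := fun p => 
    (pow_eq_one_iff_of_nonneg (norm_nonneg _) two_ne_zero).mp (by rw [← norm_pow, hc, norm_one])
  have hinj : Function.Injective q := by
    intro p p' hpp
    have h1 : M * pauliString p * Mᴴ = (c p * c p') • (M * pauliString p' * Mᴴ) := by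
      rw [h p, h p', hpp, smul_smul, mul_assoc, ← sq, hc, mul_one]
    have h2 : ∀ A : Matrix (Bits ι) (Bits ι) ℂ, Mᴴ * (M * A * Mᴴ) * M = A := by
      intro A
      calc _ = (Mᴴ * M) * A * (Mᴴ * M) := by simp only [Matrix.mul_assoc]
        _ = A := by rw [hU, Matrix.one_mul, Matrix.mul_one]
    have h3 := congrArg (fun A => Mᴴ * A * M) h1
    simp only [Matrix.mul_smul, Matrix.smul_mul, h2] at h3
    exact eq_of_pauliString_eq_smul h3
  have hbij : Function.Bijective q := Finite.injective_iff_bijective.mp hinj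
  unfold pauliMoment
  rw [← hbij.sum_comp]
  refine Finset.sum_congr rfl fun p _ => ?_
  rw [← expectation_conj C (pauliString p) ψ, h p]
  have : expectation (c p • pauliString (q p)) (act C ψ)
      = c p * expectation (pauliString (q p)) (act C ψ) := by
    simp [expectation, Matrix.smul_mulVec, dotProduct_smul]
  rw [this, norm_mul, hnorm, one_mul]

end Unitary

/-! ### Composite registers -/

section Registers

variable {α β : Type}

theorem sum_sumArrow {T M : Type*} [Fintype α] [Fintype β] [DecidableEq α] [DecidableEq β]
    [Fintype T] [AddCommMonoid M] (f : (α ⊕ β → T) → M) :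
    ∑ x, f x = ∑ a, ∑ b, f (Sum.elim a b) := by
  rw [← Fintype.sum_prod_type', ← (Equiv.sumArrowEquivProdArrow α β T).symm.sum_comp]
  rfl

theorem pauliString_sum [Fintype α] [Fintype β] (p : α ⊕ β → Fin 4) :
    pauliString p = tensorOp (pauliString (p ∘ Sum.inl)) (pauliString (p ∘ Sum.inr)) := by
  ext x y
  simp [pauliString, tensorOp, Fintype.prod_sum_type]

theorem tensorOp_conjTranspose (U : Matrix (Bits α) (Bits α) ℂ) (V : Matrix (Bits β) (Bits β) ℂ) :
    (tensorOp U V)ᴴ = tensorOp Uᴴ Vᴴ := by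
  ext x y
  simp [tensorOp]

theorem tensorOp_one [Fintype α] [Fintype β] :
    tensorOp (1 : Matrix (Bits α) (Bits α) ℂ) (1 : Matrix (Bits β) (Bits β) ℂ) = 1 := by
  ext x y
  have : x = y ↔ x ∘ Sum.inl = y ∘ Sum.inl ∧ x ∘ Sum.inr = y ∘ Sum.inr := by
    simp [funext_iff]
  by_cases h1 : x ∘ Sum.inl = y ∘ Sum.inl <;> by_cases h2 : x ∘ Sum.inr = y ∘ Sum.inr <;>
    simp [tensorOp, Matrix.one_apply, this, h1, h2]

/-- The state `|ψ⟩|0⋯0⟩`. -/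
noncomputable def padZero (β : Type) [Fintype β] (ψ : QState α) :
    QState (α ⊕ β) :=
  WithLp.toLp 2 fun x => if x ∘ Sum.inr = 0 then ψ (x ∘ Sum.inl) else 0

theorem padZero_ne_zero [Fintype β] {ψ : QState α} (hψ : ψ ≠ 0) : padZero β ψ ≠ 0 := by
  intro h
  refine hψ (PiLp.ext fun x => ?_)
  have := congrArg (fun φ : QState (α ⊕ β) => φ (Sum.elim x 0)) h
  simpa [padZero] using this

variable [Fintype α] [Fintype β] [DecidableEq α] [DecidableEq β]

theorem tensorOp_mul (U U' : Matrix (Bits α) (Bits α) ℂ) (V V' : Matrix (Bits β) (Bits β) ℂ) :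
    tensorOp U V * tensorOp U' V' = tensorOp (U * U') (V * V') := by
  ext x z
  simp only [tensorOp, Matrix.mul_apply, Matrix.of_apply, sum_sumArrow, Finset.sum_mul_sum,
    Sum.elim_comp_inl, Sum.elim_comp_inr]
  refine Finset.sum_congr rfl fun _ _ => Finset.sum_congr rfl fun _ _ => ?_
  ring

/-- The unitary `U ⊗ V` on the joint register. -/
noncomputable def tensorUnitary (U : Matrix.unitaryGroup (Bits α) ℂ)
    (V : Matrix.unitaryGroup (Bits β) ℂ) : Matrix.unitaryGroup (Bits (α ⊕ β)) ℂ :=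
  ⟨tensorOp U V, by
    rw [Matrix.mem_unitaryGroup_iff, Matrix.star_eq_conjTranspose, tensorOp_conjTranspose,
      tensorOp_mul, ← Matrix.star_eq_conjTranspose, ← Matrix.star_eq_conjTranspose,
      Unitary.mul_star_self_of_mem U.2, Unitary.mul_star_self_of_mem V.2, tensorOp_one]⟩

theorem localAct_eq_act (U : Matrix.unitaryGroup (Bits α) ℂ) (V : Matrix.unitaryGroup (Bits β) ℂ)
    (ψ : QState (α ⊕ β)) : localAct U V ψ = act (tensorUnitary U V) ψ := rfl

theorem localAct_apply (U : Matrix.unitaryGroup (Bits α) ℂ) (V : Matrix.unitaryGroup (Bits β) ℂ)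
    (ψ : QState (α ⊕ β)) (x : Bits (α ⊕ β)) :
    localAct U V ψ x = ∑ a, ∑ b, U.1 (x ∘ Sum.inl) a * V.1 (x ∘ Sum.inr) b * ψ (Sum.elim a b) := by
  simp [localAct, Matrix.mulVec, dotProduct, sum_sumArrow, tensorOp]

theorem IsClifford.tensorUnitary {C : Matrix.unitaryGroup (Bits α) ℂ}
    {D : Matrix.unitaryGroup (Bits β) ℂ} (hC : IsClifford C) (hD : IsClifford D) :
    IsClifford (tensorUnitary C D) := by
  intro p
  obtain ⟨q, c, hq⟩ := hC (p ∘ Sum.inl)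
  obtain ⟨r, d, hr⟩ := hD (p ∘ Sum.inr)
  refine ⟨Sum.elim q r, c * d, ?_⟩
  rw [pauliString_sum, pauliString_sum]
  change tensorOp _ _ * _ * (tensorOp _ _)ᴴ = _
  rw [tensorOp_conjTranspose, tensorOp_mul, tensorOp_mul, hq, hr]
  ext x y
  simp [tensorOp]
  ring

/-- On the ancillas only the diagonal entry at `0` of each Pauli matrix contributes. -/
theorem expectation_padZero (p : α ⊕ β → Fin 4) (ψ : QState α) :
    expectation (pauliString p) (padZero β ψ)
      = expectation (pauliString (p ∘ Sum.inl)) ψ * ∏ k, pauli (p (Sum.inr k)) 0 0 := by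
  simp only [expectation_eq_sum, sum_sumArrow, pauliString_sum p, padZero, tensorOp,
    Matrix.of_apply, Sum.elim_comp_inl, Sum.elim_comp_inr, Finset.sum_mul]
  refine Finset.sum_congr rfl fun a _ => ?_
  rw [Finset.sum_eq_single 0]
  · refine Finset.sum_congr rfl fun b _ => ?_
    rw [Finset.sum_eq_single 0]
    · simp [pauliString]; ring
    · intro y _ hy; simp [hy]
    · simp
  · intro y _ hy; simp [hy]
  · simp

theorem pauliMoment_padZero (ψ : QState α) :
    pauliMoment (padZero β ψ) = pauliMoment ψ * 2 ^ Fintype.card β := by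
  have h : ∑ q : β → Fin 4, ∏ k, ‖pauli (q k) 0 0‖ ^ 4 = (2 : ℝ) ^ Fintype.card β := by
    rw [← Fintype.prod_sum fun (_ : β) i => ‖pauli i 0 0‖ ^ 4]
    have : ∑ i, ‖pauli i 0 0‖ ^ 4 = (2 : ℝ) := by
      simp [pauli, Fin.sum_univ_four]; norm_num
    simp [this, Finset.card_univ]
  rw [← h]
  simp only [pauliMoment, sum_sumArrow, expectation_padZero, Finset.sum_mul_sum, norm_mul, mul_pow,
    norm_prod, Finset.prod_pow, Sum.elim_comp_inl, Sum.elim_inr]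

/-- Ancilla qubits in the state `|0⟩` do not change the stabilizer entropy. -/
theorem stabRenyi_padZero {ψ : QState α} (hψ : ψ ≠ 0) :
    stabRenyi (padZero β ψ) = stabRenyi ψ := by
  rw [stabRenyi_eq hψ, stabRenyi_eq (padZero_ne_zero hψ), pauliMoment_padZero, Fintype.card_sum,
    pow_add, mul_div_mul_right _ _ (by positivity)]

/-- The state `ψ` with its qubits relabelled along `e`. -/
noncomputable def relabel (e : α ≃ β) (ψ : QState α) : QState β :=
  WithLp.toLp 2 fun x => ψ (x ∘ e)

theorem stabRenyi_relabel (e : α ≃ β) (ψ : QState α) :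
    stabRenyi (relabel e ψ) = stabRenyi ψ := by
  have hexp : ∀ p : β → Fin 4, expectation (pauliString p) (relabel e ψ)
      = expectation (pauliString (p ∘ e)) ψ := by
    intro p
    simp only [expectation_eq_sum]
    refine Fintype.sum_equiv (e.symm.arrowCongr (Equiv.refl _)) _ _ fun x => ?_
    refine Fintype.sum_equiv (e.symm.arrowCongr (Equiv.refl _)) _ _ fun y => ?_
    have : pauliString (p ∘ e) (x ∘ e) (y ∘ e) = pauliString p x y := by
      simp only [pauliString_apply, Function.comp_apply]
      exact e.prod_comp fun k => pauli (p k) (x k) (y k)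
    rw [← this]
    rfl
  have hmom : pauliMoment (relabel e ψ) = pauliMoment ψ := by
    simp only [pauliMoment, hexp]
    exact Fintype.sum_equiv (e.symm.arrowCongr (Equiv.refl _)) _ _ fun x => rfl
  simp only [stabRenyi, sum_pauliProb_sq, hmom, Fintype.card_congr e]

/-- Restricting the sum over Pauli strings to the strings `P ⊗ P` bounds the moment from below by
the overlap with the unnormalised maximally entangled state `∑_a |a⟩|a⟩`. -/
theorem le_pauliMoment_of_maximallyEntangled (ψ : QState (α ⊕ α)) :
    (2 ^ Fintype.card α * ‖∑ a, ψ (Sum.elim a a)‖ ^ 2) ^ 4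
      ≤ ((4 : ℝ) ^ Fintype.card α) ^ 3 * pauliMoment ψ := by
  choose c hc hstar using exists_star_pauliString (ι := α)
  set E : (α → Fin 4) → ℂ := fun p => expectation (pauliString (Sum.elim p p)) ψ
  have hsum : ∑ p, c p * E p
      = 2 ^ Fintype.card α * (star (∑ a, ψ (Sum.elim a a)) * ∑ a, ψ (Sum.elim a a)) := by
    have h1 : ∀ p, c p * E p = ∑ a, ∑ b, ∑ a', ∑ b', star (ψ (Sum.elim a b)) * ψ (Sum.elim a' b') *
        (pauliString p a a' * star (pauliString p b b')) := by
      intro p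
      simp only [E, expectation_eq_sum, sum_sumArrow, pauliString_sum (Sum.elim p p), tensorOp,
        Matrix.of_apply, Sum.elim_comp_inl, Sum.elim_comp_inr, Finset.mul_sum, hstar]
      refine Finset.sum_congr rfl fun _ _ => Finset.sum_congr rfl fun _ _ =>
        Finset.sum_congr rfl fun _ _ => Finset.sum_congr rfl fun _ _ => ?_
      ring
    simp only [h1]
    rw [Finset.sum_comm, star_sum, Finset.sum_mul, Finset.mul_sum]
    refine Finset.sum_congr rfl fun a _ => ?_
    rw [Finset.sum_comm, Finset.sum_eq_single a, Finset.sum_comm, Finset.mul_sum, Finset.mul_sum]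
    · refine Finset.sum_congr rfl fun a' _ => ?_
      rw [Finset.sum_comm, Finset.sum_eq_single a']
      · rw [← Finset.mul_sum, pauliString_completeness]; simp; ring
      · intro b' _ hb'
        rw [← Finset.mul_sum, pauliString_completeness]; simp [Ne.symm hb']
      · simp
    · intro b _ hb
      rw [Finset.sum_comm]
      refine Finset.sum_eq_zero fun a' _ => ?_
      rw [Finset.sum_comm]
      refine Finset.sum_eq_zero fun b' _ => ?_
      rw [← Finset.mul_sum, pauliString_completeness]; simp [Ne.symm hb]
    · simp
  have hle : 2 ^ Fintype.card α * ‖∑ a, ψ (Sum.elim a a)‖ ^ 2 ≤ ∑ p, ‖E p‖ := by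
    calc _ = ‖∑ p, c p * E p‖ := by
          rw [hsum, norm_mul, norm_mul, norm_star, norm_pow]; simp [sq]
      _ ≤ ∑ p, ‖c p * E p‖ := norm_sum_le _ _
      _ = ∑ p, ‖E p‖ := by simp only [norm_mul, hc, one_mul]
  have hpow := pow_sum_le_card_mul_sum_pow (s := Finset.univ) (f := fun p => ‖E p‖)
    (fun _ _ => norm_nonneg _) 3
  have hcard : ((Finset.univ : Finset (α → Fin 4)).card : ℝ) = 4 ^ Fintype.card α := by
    simp [Finset.card_univ]
  rw [hcard] at hpow
  refine (pow_le_pow_left₀ (by positivity) hle 4).trans (hpow.trans ?_)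
  refine mul_le_mul_of_nonneg_left ?_ (by positivity)
  have hinj : Function.Injective fun p : α → Fin 4 => (Sum.elim p p : α ⊕ α → Fin 4) := by
    intro p q h
    simpa using congrArg (· ∘ Sum.inl) h
  calc ∑ p, ‖E p‖ ^ 4
      = ∑ r ∈ Finset.univ.image fun p : α → Fin 4 => (Sum.elim p p : α ⊕ α → Fin 4),
          ‖expectation (pauliString r) ψ‖ ^ 4 :=
        (Finset.sum_image (f := fun r => ‖expectation (pauliString r) ψ‖ ^ 4) hinj.injOn).symm
    _ ≤ pauliMoment ψ :=
        Finset.sum_le_sum_of_subset_of_nonneg (Finset.subset_univ _) fun _ _ _ => by positivity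

end Registers

/-! ### Computational basis labels -/

section Label

/-- The number whose binary digits, least significant first, are `x`. -/
def label {n : ℕ} (x : Bits (Fin n)) : ℕ := finFunctionFinEquiv x

theorem label_eq {n : ℕ} (x : Bits (Fin n)) : label x = ∑ i, (x i : ℕ) * 2 ^ (i : ℕ) :=
  finFunctionFinEquiv_apply x

theorem label_lt {n : ℕ} (x : Bits (Fin n)) : label x < 2 ^ n := (finFunctionFinEquiv x).2

theorem label_injective {n : ℕ} : Function.Injective (label : Bits (Fin n) → ℕ) := fun _ _ h =>
  finFunctionFinEquiv.injective (Fin.ext h)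

theorem exists_label_eq {n j : ℕ} (h : j < 2 ^ n) : ∃ x : Bits (Fin n), label x = j :=
  ⟨finFunctionFinEquiv.symm ⟨j, h⟩, by simp [label]⟩

theorem sum_label {n : ℕ} {M : Type*} [AddCommMonoid M] (f : ℕ → M) :
    ∑ x : Bits (Fin n), f (label x) = ∑ j ∈ Finset.range (2 ^ n), f j := by
  rw [Finset.sum_range]
  exact finFunctionFinEquiv.sum_comp fun i : Fin (2 ^ n) => f i

/-- The first `m` bits are the less significant ones. -/
theorem label_add {m k : ℕ} (x : Bits (Fin (m + k))) :
    label x = label (x ∘ Fin.castAdd k) + 2 ^ m * label (x ∘ Fin.natAdd m) := by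
  simp only [label_eq, Fin.sum_univ_add, Function.comp_apply, Fin.val_castAdd, Fin.val_natAdd,
    Finset.mul_sum]
  congr 1
  refine Finset.sum_congr rfl fun i _ => ?_
  ring

theorem label_eq_zero_iff {n : ℕ} {x : Bits (Fin n)} : label x = 0 ↔ x = 0 := by
  rw [← label_injective.eq_iff (b := 0)]
  simp [label_eq]

end Label

/-! ### Diagonal states and the spectral estimate -/

/-- The bipartite state `∑_j √(lam j) |j⟩|j⟩`, where `|j⟩` is the computational basis vector
labelled by the binary digits of `j` and `j` runs over the numbers below `2 ^ min a b`. -/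
noncomputable def diagState (a b : ℕ) (lam : ℕ → ℝ) : QState (Fin a ⊕ Fin b) :=
  WithLp.toLp 2 fun x =>
    if label (x ∘ Sum.inl) = label (x ∘ Sum.inr) then (√(lam (label (x ∘ Sum.inl))) : ℂ) else 0

theorem diagState_apply (a b : ℕ) (lam : ℕ → ℝ) (x : Bits (Fin a)) (y : Bits (Fin b)) :
    diagState a b lam (Sum.elim x y) = if label x = label y then (√(lam (label x)) : ℂ) else 0 :=
  rfl

theorem diagState_ne_zero {m : ℕ} {lam : ℕ → ℝ} {j : ℕ} (hj : j < 2 ^ m) (hlam : 0 < lam j) :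
    diagState m m lam ≠ 0 := by
  intro h
  obtain ⟨x, rfl⟩ := exists_label_eq hj
  have h1 := congrArg (fun φ : QState (Fin m ⊕ Fin m) => φ (Sum.elim x x)) h
  rw [diagState_apply, if_pos rfl] at h1
  exact (Real.sqrt_pos.mpr hlam).ne' (by simpa using h1)

/-- If only the first `2 ^ m` coefficients are nonzero, all but `m` qubits on either side are in
the state `|0⟩`. -/
theorem diagState_add (m a b : ℕ) {lam : ℕ → ℝ} (hlam : ∀ j, 2 ^ m ≤ j → lam j = 0) :
    diagState (m + a) (m + b) lam
      = relabel ((Equiv.sumSumSumComm _ _ _ _).trans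
          (Equiv.sumCongr finSumFinEquiv finSumFinEquiv))
          (padZero (Fin a ⊕ Fin b) (diagState m m lam)) := by
  refine PiLp.ext fun x => ?_
  obtain ⟨⟨y, z⟩, rfl⟩ := (Equiv.sumArrowEquivProdArrow _ _ _).symm.surjective x
  change diagState _ _ lam (Sum.elim y z) = _
  set y₀ := y ∘ Fin.castAdd a
  set y₁ := y ∘ Fin.natAdd m
  set z₀ := z ∘ Fin.castAdd b
  set z₁ := z ∘ Fin.natAdd m
  have hrhs : relabel ((Equiv.sumSumSumComm _ _ _ _).trans
          (Equiv.sumCongr finSumFinEquiv finSumFinEquiv))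
          (padZero (Fin a ⊕ Fin b) (diagState m m lam)) (Sum.elim y z)
      = if (Sum.elim y₁ z₁ : Bits (Fin a ⊕ Fin b)) = 0
          then diagState m m lam (Sum.elim y₀ z₀) else 0 := by
    have h1 : (Sum.elim y z ∘ ((Equiv.sumSumSumComm _ _ _ _).trans
          (Equiv.sumCongr finSumFinEquiv finSumFinEquiv))) ∘ Sum.inr = Sum.elim y₁ z₁ := by
      funext k; rcases k with k | k <;> simp [y₁, z₁]
    have h2 : (Sum.elim y z ∘ ((Equiv.sumSumSumComm _ _ _ _).trans
          (Equiv.sumCongr finSumFinEquiv finSumFinEquiv))) ∘ Sum.inl = Sum.elim y₀ z₀ := by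
      funext k; rcases k with k | k <;> simp [y₀, z₀]
    simp only [relabel, padZero, h1, h2]
  have hzero : (Sum.elim y₁ z₁ : Bits (Fin a ⊕ Fin b)) = 0 ↔ label y₁ = 0 ∧ label z₁ = 0 := by
    simp [label_eq_zero_iff, funext_iff]
  change _ = relabel _ _ (Sum.elim y z)
  rw [hrhs, diagState_apply, diagState_apply, label_add y, label_add z]
  have hy := label_lt y₀
  have hz := label_lt z₀
  simp only [hzero]
  change (if label y₀ + 2 ^ m * label y₁ = label z₀ + 2 ^ m * label z₁ then
    (√(lam (label y₀ + 2 ^ m * label y₁)) : ℂ) else 0) = _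
  by_cases h1 : label y₁ = 0
  · by_cases h2 : label z₁ = 0
    · simp [h1, h2]
    · have : label y₀ ≠ label z₀ + 2 ^ m * label z₁ := by
        have := Nat.le_mul_of_pos_right (2 ^ m) (Nat.pos_of_ne_zero h2)
        omega
      simp [h1, h2, this]
  · have := Nat.le_mul_of_pos_right (2 ^ m) (Nat.pos_of_ne_zero h1)
    simp [h1, hlam (label y₀ + 2 ^ m * label y₁) (by omega)]

/-- The entropy of a diagonal state does not depend on the sizes of the two registers, as long as
they can hold all nonzero coefficients. -/
theorem stabRenyi_diagState {m a b : ℕ} (ha : m ≤ a) (hb : m ≤ b) {lam : ℕ → ℝ}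
    (hlam : ∀ j, 2 ^ m ≤ j → lam j = 0) (h0 : diagState m m lam ≠ 0) :
    stabRenyi (diagState a b lam) = stabRenyi (diagState m m lam) := by
  obtain ⟨a, rfl⟩ := Nat.exists_eq_add_of_le ha
  obtain ⟨b, rfl⟩ := Nat.exists_eq_add_of_le hb
  rw [diagState_add m a b hlam, stabRenyi_relabel, stabRenyi_padZero h0]

/-- The state entering the spectral estimate is `(C ⊗ C) ∑_j √(lam j) |j⟩|j⟩`. -/
theorem estimateState_eq_localAct {n : ℕ} (C : Matrix.unitaryGroup (Bits (Fin n)) ℂ)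
    (lam : ℕ → ℝ) :
    estimateState C (fun i => lam i) = localAct C C (diagState n n lam) := by
  refine PiLp.ext fun x => ?_
  rw [localAct_apply]
  have h : ∀ a b : Bits (Fin n), diagState n n lam (Sum.elim a b)
      = if a = b then (√(lam (label a)) : ℂ) else 0 := fun a b => by
    simp only [diagState_apply, label_injective.eq_iff]
  simp only [h, mul_ite, mul_zero, Finset.sum_ite_eq, Finset.mem_univ, if_true, estimateState]
  rw [← finFunctionFinEquiv.sum_comp]
  refine Finset.sum_congr rfl fun a _ => ?_
  simp [stabilizerBasis, label, mul_comm]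

/-- The spectral estimate does not depend on the Clifford unitary. -/
theorem spectralEstimate_eq {n : ℕ} {C : Matrix.unitaryGroup (Bits (Fin n)) ℂ}
    (hC : IsClifford C) (lam : ℕ → ℝ) :
    spectralEstimate C (fun i => lam i) = stabRenyi (diagState n n lam) := by
  rw [spectralEstimate, estimateState_eq_localAct, localAct_eq_act]
  exact stabRenyi_congr ((hC.tensorUnitary hC).pauliMoment_act _)

/-! ### Entropy bounds for diagonal states -/

section Bounds

variable {n : ℕ} {lam : ℕ → ℝ}

theorem sum_norm_diagState_pow_four (hlam : ∀ j, 0 ≤ lam j) :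
    ∑ x, ‖diagState n n lam x‖ ^ 4 = ∑ j ∈ Finset.range (2 ^ n), lam j ^ 2 := by
  rw [sum_sumArrow, ← sum_label]
  refine Finset.sum_congr rfl fun x _ => ?_
  rw [Finset.sum_eq_single x]
  · rw [diagState_apply, if_pos rfl, Complex.norm_real, Real.norm_of_nonneg (Real.sqrt_nonneg _)]
    nth_rewrite 2 [← Real.sq_sqrt (hlam (label x))]
    ring
  · intro y _ hy
    rw [diagState_apply, if_neg (label_injective.ne (Ne.symm hy))]
    simp
  · simp

theorem stabRenyi_diagState_le_collision (hlam : ∀ j, 0 ≤ lam j) (h0 : diagState n n lam ≠ 0) :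
    stabRenyi (diagState n n lam)
      ≤ -(2 * Real.log (∑ j ∈ Finset.range (2 ^ n), lam j ^ 2)) := by
  have h := le_pauliMoment_of_computational (diagState n n lam)
  have hpos := sum_norm_pow_four_pos h0
  rw [sum_norm_diagState_pow_four hlam] at h hpos
  rw [stabRenyi_eq h0, neg_le_neg_iff]
  have : (2 : ℝ) * Real.log (∑ j ∈ Finset.range (2 ^ n), lam j ^ 2)
      = Real.log ((∑ j ∈ Finset.range (2 ^ n), lam j ^ 2) ^ 2) := by
    rw [Real.log_pow]; norm_num
  rw [this]
  refine Real.log_le_log (by positivity) ?_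
  rw [le_div_iff₀ (by positivity), mul_comm]
  exact h

theorem stabRenyi_diagState_le_overlap (hsum : 0 < ∑ j ∈ Finset.range (2 ^ n), √(lam j))
    (h0 : diagState n n lam ≠ 0) :
    stabRenyi (diagState n n lam)
      ≤ 4 * (n * Real.log 2 - 2 * Real.log (∑ j ∈ Finset.range (2 ^ n), √(lam j))) := by
  have h := le_pauliMoment_of_maximallyEntangled (diagState n n lam)
  have hs : ‖∑ x : Bits (Fin n), diagState n n lam (Sum.elim x x)‖
      = ∑ j ∈ Finset.range (2 ^ n), √(lam j) := by
    simp only [diagState_apply, if_true]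
    rw [← Complex.ofReal_sum, sum_label (fun j => √(lam j)), Complex.norm_real,
      Real.norm_of_nonneg hsum.le]
  rw [hs] at h
  set s := ∑ j ∈ Finset.range (2 ^ n), √(lam j)
  rw [stabRenyi_eq h0, neg_le]
  have h4 : (4 : ℝ) ^ n = 2 ^ n * 2 ^ n := by rw [← mul_pow]; norm_num
  have hlog : -(4 * (n * Real.log 2 - 2 * Real.log s)) = Real.log (s ^ 8 / (2 ^ n) ^ 4) := by
    rw [Real.log_div (by positivity) (by positivity), Real.log_pow, Real.log_pow, Real.log_pow]
    push_cast
    ring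
  rw [hlog]
  refine Real.log_le_log (by positivity) ?_
  simp only [Fintype.card_sum, Fintype.card_fin, h4] at h ⊢
  rw [pow_add, div_le_div_iff₀ (by positivity) (by positivity)]
  have hd : (0 : ℝ) < 2 ^ n := by positivity
  refine le_of_mul_le_mul_left ?_ (pow_pos hd 2)
  calc (2 ^ n) ^ 2 * (s ^ 8 * (2 ^ n * 2 ^ n)) = (2 ^ n * s ^ 2) ^ 4 := by ring
    _ ≤ _ := h
    _ = _ := by ring

end Bounds

/-! ### Schmidt decomposition -/

section Schmidt

/-- The unitary whose rows are the conjugates of an orthonormal basis, so that it maps this basis to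
the computational one. -/
noncomputable def basisUnitary {ι : Type} [Fintype ι] [DecidableEq ι]
    (w : OrthonormalBasis ι ℂ (EuclideanSpace ℂ ι)) : Matrix.unitaryGroup ι ℂ :=
  ⟨Matrix.of fun i k => star (w i k), by
    rw [Matrix.mem_unitaryGroup_iff]
    ext i j
    have h := orthonormal_iff_ite.mp w.orthonormal i j
    rw [PiLp.inner_apply] at h
    simp only [Matrix.mul_apply, Matrix.star_apply, Matrix.of_apply, star_star, Matrix.one_apply]
    rw [← h]
    exact Finset.sum_congr rfl fun k _ => mul_comm _ _⟩

variable {a b : ℕ} (ψ : QState (Fin a ⊕ Fin b))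

/-- The eigenvalues of `ρ_A` in descending order, continued by zeros to an infinite sequence. -/
noncomputable def spectrumSeq (j : ℕ) : ℝ :=
  if h : j < Fintype.card (Bits (Fin a)) then
    (reducedA_isHermitian ψ).eigenvalues₀ ⟨j, h⟩
  else 0

/-- The coefficient matrix of a bipartite state. -/
noncomputable def coeffMatrix : Matrix (Bits (Fin a)) (Bits (Fin b)) ℂ :=
  Matrix.of fun x y => ψ (Sum.elim x y)

theorem reducedA_eq : reducedA ψ = coeffMatrix ψ * (coeffMatrix ψ)ᴴ := by
  ext x x'
  simp [reducedA, coeffMatrix, Matrix.mul_apply]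

open scoped ComplexOrder in
theorem reducedA_posSemidef : (reducedA ψ).PosSemidef := by
  rw [reducedA_eq]
  exact Matrix.posSemidef_self_mul_conjTranspose _

/-- The numbering of the eigenvalues of `ρ_A` by computational basis labels, in the descending order
of the eigenvalues. -/
noncomputable def eigenIndex (a : ℕ) : Bits (Fin a) ≃ Bits (Fin a) :=
  (finFunctionFinEquiv.trans (finCongr (by simp))).trans
    (Fintype.equivOfCardEq (Fintype.card_fin (Fintype.card (Bits (Fin a)))))

theorem eigenvalues_eigenIndex (x : Bits (Fin a)) :
    (reducedA_isHermitian ψ).eigenvalues (eigenIndex a x) = spectrumSeq ψ (label x) := by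
  have h : label x < Fintype.card (Bits (Fin a)) := by simpa using label_lt x
  rw [spectrumSeq, dif_pos h, Matrix.IsHermitian.eigenvalues]
  congr 1
  simp [eigenIndex, label, Fin.ext_iff]

theorem spectrumSeq_nonneg (j : ℕ) : 0 ≤ spectrumSeq ψ j := by
  by_cases h : j < 2 ^ a
  · obtain ⟨x, rfl⟩ := exists_label_eq h
    rw [← eigenvalues_eigenIndex]
    exact (reducedA_posSemidef ψ).eigenvalues_nonneg _
  · rw [spectrumSeq, dif_neg (by simpa using h)]

theorem spectrumSeq_antitone : Antitone (spectrumSeq ψ) := by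
  intro i j hij
  by_cases hj : j < Fintype.card (Bits (Fin a))
  · rw [spectrumSeq, spectrumSeq, dif_pos hj, dif_pos (hij.trans_lt hj)]
    exact (reducedA_isHermitian ψ).eigenvalues₀_antitone hij
  · rw [spectrumSeq, dif_neg hj]
    exact spectrumSeq_nonneg ψ i

theorem lt_two_pow_of_spectrumSeq_ne_zero {j : ℕ} (hj : spectrumSeq ψ j ≠ 0) : j < 2 ^ a := by
  by_contra h
  exact hj (by rw [spectrumSeq, dif_neg (by simpa using h)])

/-- As the eigenvalues are in descending order, the nonzero ones come first. -/
theorem lt_schmidtRank_of_spectrumSeq_ne_zero {j : ℕ} (hj : spectrumSeq ψ j ≠ 0) :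
    j < schmidtRank ψ := by
  have hja := lt_two_pow_of_spectrumSeq_ne_zero ψ hj
  rw [schmidtRank, (reducedA_isHermitian ψ).rank_eq_card_non_zero_eigs]
  have key : ∀ i : Fin (j + 1), ∃ x : Bits (Fin a), label x = i := fun i =>
    exists_label_eq ((Nat.lt_succ_iff.mp i.2).trans_lt hja)
  choose x hx using key
  let f : Fin (j + 1) → {i // (reducedA_isHermitian ψ).eigenvalues i ≠ 0} := fun i =>
    ⟨eigenIndex a (x i), by
      rw [eigenvalues_eigenIndex, hx]
      exact ((lt_of_le_of_ne (spectrumSeq_nonneg ψ j) (Ne.symm hj)).trans_le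
        (spectrumSeq_antitone ψ (Nat.lt_succ_iff.mp i.2))).ne'⟩
  have hf : Function.Injective f := by
    intro i i' h
    have h1 : x i = x i' := (eigenIndex a).injective (congrArg Subtype.val h)
    exact Fin.ext (by rw [← hx, ← hx, h1])
  simpa using Fintype.card_le_of_injective f hf

theorem schmidtRank_le_left : schmidtRank ψ ≤ 2 ^ a := by
  simpa [schmidtRank] using (reducedA ψ).rank_le_card_width

theorem schmidtRank_le_right : schmidtRank ψ ≤ 2 ^ b := by
  rw [schmidtRank, reducedA_eq]
  refine (Matrix.rank_mul_le_left _ _).trans ?_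
  simpa using (coeffMatrix ψ).rank_le_card_width

theorem spectrumSeq_eq_zero {j : ℕ} (hj : schmidtRank ψ ≤ j) : spectrumSeq ψ j = 0 := by
  by_contra h
  exact absurd (lt_schmidtRank_of_spectrumSeq_ne_zero ψ h) (not_lt.mpr hj)

/-- The Schmidt decomposition: local unitaries bring `ψ` into diagonal form in the computational
bases. -/
theorem exists_localAct_eq_diagState :
    ∃ U V, localAct U V ψ = diagState a b (spectrumSeq ψ) := by
  set lam := spectrumSeq ψ
  set hA := reducedA_isHermitian ψ
  let w := hA.eigenvectorBasis.reindex (eigenIndex a).symm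
  have hw : ∀ x, w x = hA.eigenvectorBasis (eigenIndex a x) := fun x => by simp [w]
  -- the rows of the coefficient matrix in the eigenbasis of `ρ_A`
  let N : Bits (Fin a) → QState (Fin b) := fun x =>
    WithLp.toLp 2 fun y => ∑ k, star (w x k) * ψ (Sum.elim k y)
  have hN : ∀ x x', inner ℂ (N x') (N x) = if x = x' then (lam (label x) : ℂ) else 0 := by
    intro x x'
    have h1 : ∀ k, (reducedA ψ *ᵥ (w x').ofLp) k = lam (label x') * w x' k := by
      intro k
      rw [hw, hA.mulVec_eigenvectorBasis, eigenvalues_eigenIndex]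
      simp [lam]
    have h2 := orthonormal_iff_ite.mp w.orthonormal x x'
    rw [PiLp.inner_apply] at h2
    have h3 : inner ℂ (N x') (N x) = ∑ k, star (w x k) * (reducedA ψ *ᵥ (w x').ofLp) k := by
      rw [PiLp.inner_apply]
      simp only [N, RCLike.inner_apply, Matrix.mulVec, dotProduct, reducedA, Matrix.of_apply,
        map_sum, map_mul, Finset.mul_sum, Finset.sum_mul]
      rw [Finset.sum_comm]
      conv_rhs => rw [Finset.sum_comm]
      refine Finset.sum_congr rfl fun k _ => ?_
      rw [Finset.sum_comm]
      refine Finset.sum_congr rfl fun k' _ => Finset.sum_congr rfl fun y _ => ?_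
      simp
      ring
    rw [h3]
    simp only [h1]
    have h4 : ∑ k, star (w x k) * (lam (label x') * w x' k)
        = lam (label x') * ∑ k, inner ℂ (w x k) (w x' k) := by
      rw [Finset.mul_sum]
      refine Finset.sum_congr rfl fun k _ => ?_
      simp
      ring
    rw [h4, h2]
    split_ifs with h
    · rw [h, mul_one]
    · rw [mul_zero]
  -- the normalised rows, transported to the labels of the second register
  -- (`r y` is the vector of bits with the same label as `y`, if there is one)
  let r : Bits (Fin b) → Bits (Fin a) := fun y => Function.invFun label (label y)
  have hr : ∀ {x y}, label x = label y → r y = x := fun {x y} h => by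
    simp only [r, ← h]
    exact Function.leftInverse_invFun label_injective x
  let v : Bits (Fin b) → QState (Fin b) := fun y => ((√(lam (label y)))⁻¹ : ℂ) • N (r y)
  let s : Set (Bits (Fin b)) := {y | lam (label y) ≠ 0}
  have hsq : ∀ j, (√(lam j) : ℂ) * √(lam j) = lam j := fun j => by
    rw [← Complex.ofReal_mul, Real.mul_self_sqrt (spectrumSeq_nonneg ψ j)]
  have hsqrt : ∀ {j}, lam j ≠ 0 → (√(lam j) : ℂ) ≠ 0 := fun {j} h => by
    rw [Complex.ofReal_ne_zero]
    exact Real.sqrt_ne_zero'.mpr (lt_of_le_of_ne (spectrumSeq_nonneg ψ j) (Ne.symm h))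
  -- `v` is orthonormal only at the labels of nonzero eigenvalues, elsewhere it vanishes since `0⁻¹ = 0`
  have hv : Orthonormal ℂ (s.domRestrict v) := by
    rw [orthonormal_iff_ite]
    rintro ⟨y, hy⟩ ⟨y', hy'⟩
    obtain ⟨x, hx⟩ := exists_label_eq (lt_two_pow_of_spectrumSeq_ne_zero ψ hy)
    obtain ⟨x', hx'⟩ := exists_label_eq (lt_two_pow_of_spectrumSeq_ne_zero ψ hy')
    change inner ℂ (v y) (v y') = _
    simp only [v, hr hx, hr hx', inner_smul_left, inner_smul_right, hN, Subtype.mk.injEq]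
    have hiff : x' = x ↔ y = y' := by
      rw [← label_injective.eq_iff, hx, hx', label_injective.eq_iff, eq_comm]
    simp only [hiff, hx']
    split_ifs with h
    · subst h
      rw [map_inv₀, Complex.conj_ofReal, ← hsq]
      field_simp [hsqrt hy]
    · simp
  obtain ⟨u, hu⟩ := hv.exists_orthonormalBasis_extension_of_card_eq (by simp)
  refine ⟨basisUnitary w, basisUnitary u, PiLp.ext fun z => ?_⟩
  obtain ⟨⟨x, y⟩, rfl⟩ := (Equiv.sumArrowEquivProdArrow _ _ _).symm.surjective z
  change localAct _ _ ψ (Sum.elim x y) = diagState a b lam (Sum.elim x y)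
  have hval : localAct (basisUnitary w) (basisUnitary u) ψ (Sum.elim x y)
      = inner ℂ (u y) (N x) := by
    rw [localAct_apply, PiLp.inner_apply, Finset.sum_comm]
    refine Finset.sum_congr rfl fun k _ => ?_
    simp only [basisUnitary, N, RCLike.inner_apply, Finset.sum_mul]
    refine Finset.sum_congr rfl fun l _ => ?_
    simp
    ring
  rw [hval, diagState_apply]
  by_cases hx : lam (label x) = 0
  · have h0 : N x = 0 := by
      rw [← inner_self_eq_zero (𝕜 := ℂ), hN, if_pos rfl, hx, Complex.ofReal_zero]
    simp [h0, hx]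
  · obtain ⟨y₀, hy₀⟩ := exists_label_eq
      ((lt_schmidtRank_of_spectrumSeq_ne_zero ψ hx).trans_le (schmidtRank_le_right ψ))
    have hNx : N x = (√(lam (label x)) : ℂ) • u y₀ := by
      rw [hu y₀ (show lam (label y₀) ≠ 0 by rwa [hy₀])]
      simp only [v, hr hy₀.symm, hy₀]
      rw [smul_smul, mul_inv_cancel₀ (hsqrt hx), one_smul]
    rw [hNx, inner_smul_right, orthonormal_iff_ite.mp u.orthonormal, ← hy₀]
    simp only [label_injective.eq_iff, eq_comm (a := y₀), mul_ite, mul_one, mul_zero]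

theorem exists_spectrumSeq_pos {ψ : QState (Fin a ⊕ Fin b)} (hψ : ψ ≠ 0) :
    ∃ j, 0 < spectrumSeq ψ j := by
  by_contra! h
  have h0 : ∀ j, spectrumSeq ψ j = 0 := fun j => le_antisymm (h j) (spectrumSeq_nonneg ψ j)
  obtain ⟨U, V, hUV⟩ := exists_localAct_eq_diagState ψ
  refine act_ne_zero (tensorUnitary U V) hψ ?_
  rw [← localAct_eq_act, hUV]
  exact PiLp.ext fun x => by simp [diagState, h0]

/-- Truncation or continuation by zeros does not change the power sums of the spectrum. The exponent
must be nonzero since `0 ^ 0 = 1`. -/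
theorem sum_eigenvalues_rpow {n : ℕ} (hn : schmidtRank ψ ≤ 2 ^ n) {s : ℝ} (hs : s ≠ 0) :
    ∑ x, (reducedA_isHermitian ψ).eigenvalues x ^ s
      = ∑ j ∈ Finset.range (2 ^ n), spectrumSeq ψ j ^ s := by
  rw [← (eigenIndex a).sum_comp]
  simp only [eigenvalues_eigenIndex]
  rw [sum_label fun j => spectrumSeq ψ j ^ s]
  have h : ∀ {k}, schmidtRank ψ ≤ k → ∑ j ∈ Finset.range (schmidtRank ψ), spectrumSeq ψ j ^ s
      = ∑ j ∈ Finset.range k, spectrumSeq ψ j ^ s := fun {k} hk => by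
    refine Finset.sum_subset (Finset.range_mono hk) fun j _ hj => ?_
    rw [spectrumSeq_eq_zero ψ (by simpa using hj), Real.zero_rpow hs]
  rw [← h (schmidtRank_le_left ψ), h hn]

end Schmidt

/-! ### Attainment of the minimum -/

section Attained

theorem isCompact_unitaryGroup (ι : Type) [Fintype ι] [DecidableEq ι] :
    IsCompact (Matrix.unitaryGroup ι ℂ : Set (Matrix ι ι ℂ)) := by
  have hbox : IsCompact (Set.univ.pi fun _ : ι => Set.univ.pi fun _ : ι =>
      Metric.closedBall (0 : ℂ) 1) :=
    isCompact_univ_pi fun _ => isCompact_univ_pi fun _ => isCompact_closedBall 0 1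
  have hclosed : IsClosed (Matrix.unitaryGroup ι ℂ : Set (Matrix ι ι ℂ)) :=
    isClosed_unitary (R := Matrix ι ι ℂ)
  refine hbox.of_isClosed_subset hclosed fun U hU i _ j _ => ?_
  simpa using entry_norm_bound_of_unitary hU i j

theorem continuous_expectation {α : Type} [Fintype α] [DecidableEq α]
    (P : Matrix (Bits α) (Bits α) ℂ) : Continuous fun ψ : QState α => expectation P ψ := by
  simp only [expectation_eq_sum]
  fun_prop

variable {α β : Type} [Fintype α] [Fintype β] [DecidableEq α] [DecidableEq β]

theorem continuous_stabRenyi_localAct {ψ : QState (α ⊕ β)} (hψ : ψ ≠ 0) :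
    Continuous fun p : Matrix.unitaryGroup (Bits α) ℂ × Matrix.unitaryGroup (Bits β) ℂ =>
      stabRenyi (localAct p.1 p.2 ψ) := by
  have hU : ∀ i j, Continuous fun p : Matrix.unitaryGroup (Bits α) ℂ ×
      Matrix.unitaryGroup (Bits β) ℂ => p.1.1 i j := fun i j =>
    (continuous_subtype_val.comp continuous_fst).matrix_elem i j
  have hV : ∀ i j, Continuous fun p : Matrix.unitaryGroup (Bits α) ℂ ×
      Matrix.unitaryGroup (Bits β) ℂ => p.2.1 i j := fun i j =>
    (continuous_subtype_val.comp continuous_snd).matrix_elem i j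
  have hact : Continuous fun p : Matrix.unitaryGroup (Bits α) ℂ ×
      Matrix.unitaryGroup (Bits β) ℂ => localAct p.1 p.2 ψ :=
    (PiLp.continuous_toLp 2 _).comp (Continuous.matrix_mulVec
      (continuous_matrix fun i j => (hU _ _).mul (hV _ _)) continuous_const)
  have hne : ∀ p : Matrix.unitaryGroup (Bits α) ℂ × Matrix.unitaryGroup (Bits β) ℂ,
      localAct p.1 p.2 ψ ≠ 0 := fun p =>
    act_ne_zero (tensorUnitary p.1 p.2) hψ
  simp only [stabRenyi_eq (hne _)]
  refine (Continuous.log ?_ fun p => (div_pos (pauliMoment_pos (hne p)) (by positivity)).ne').neg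
  exact (continuous_finsetSum _ fun p _ =>
    ((continuous_expectation (pauliString p)).comp hact).norm.pow 4).div_const _

/-- The minimum over the local unitaries is attained. -/
theorem isLeast_nonlocalStabRenyi {ψ : QState (α ⊕ β)} (hψ : ψ ≠ 0) :
    IsLeast (localOrbitValues ψ) (nonlocalStabRenyi ψ) := by
  have : CompactSpace (Matrix.unitaryGroup (Bits α) ℂ) :=
    isCompact_iff_compactSpace.mp (isCompact_unitaryGroup _)
  have : CompactSpace (Matrix.unitaryGroup (Bits β) ℂ) :=
    isCompact_iff_compactSpace.mp (isCompact_unitaryGroup _)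
  have hrange : localOrbitValues ψ
      = Set.range fun p : Matrix.unitaryGroup (Bits α) ℂ × Matrix.unitaryGroup (Bits β) ℂ =>
        stabRenyi (localAct p.1 p.2 ψ) := by
    ext m
    simp [localOrbitValues, eq_comm]
  rw [nonlocalStabRenyi, hrange]
  exact (isCompact_range (continuous_stabRenyi_localAct hψ)).isLeast_sInf (Set.range_nonempty _)

end Attained

end NonlocalMagic

/-! ### Bounds on the non-local stabilizer entropy -/

open NonlocalMagic in
theorem mainTheorem6 (nA nB n : ℕ)
    (ψ : NonlocalMagic.QState (Fin nA ⊕ Fin nB)) (hψ : ‖ψ‖ = 1)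
    (hrank : NonlocalMagic.schmidtRank ψ ≤ 2 ^ n)
    (C : Matrix.unitaryGroup (NonlocalMagic.Bits (Fin n)) ℂ) (hC : NonlocalMagic.IsClifford C) :
    IsLeast (NonlocalMagic.localOrbitValues ψ) (NonlocalMagic.nonlocalStabRenyi ψ) ∧
    NonlocalMagic.nonlocalStabRenyi ψ ≤
      NonlocalMagic.spectralEstimate C (NonlocalMagic.schmidtSpectrum n ψ) ∧
    NonlocalMagic.spectralEstimate C (NonlocalMagic.schmidtSpectrum n ψ) ≤
      min (2 * NonlocalMagic.renyiA 2 ψ)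
        (4 * (n * Real.log 2 - NonlocalMagic.renyiA (1 / 2) ψ)) ∧
    (NonlocalMagic.schmidtRank ψ = 2 ^ n →
      NonlocalMagic.spectralEstimate C (NonlocalMagic.schmidtSpectrum n ψ) ≤
        min (2 * NonlocalMagic.renyiA 2 ψ)
          (4 * (NonlocalMagic.maxEntropyA ψ - NonlocalMagic.renyiA (1 / 2) ψ))) := by
  have hψ0 : ψ ≠ 0 := norm_ne_zero_iff.mp (by rw [hψ]; exact one_ne_zero)
  set lam := spectrumSeq ψ with hlam
  have hnonneg : ∀ j, 0 ≤ lam j := spectrumSeq_nonneg ψ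
  obtain ⟨j, hj⟩ := exists_spectrumSeq_pos hψ0
  have hjr : j < schmidtRank ψ := lt_schmidtRank_of_spectrumSeq_ne_zero ψ hj.ne'
  have hleast := isLeast_nonlocalStabRenyi hψ0
  have hest : spectralEstimate C (schmidtSpectrum n ψ) = stabRenyi (diagState n n lam) :=
    spectralEstimate_eq hC lam
  have h0 : diagState n n lam ≠ 0 := diagState_ne_zero (hjr.trans_le hrank) hj
  have hbound : spectralEstimate C (schmidtSpectrum n ψ) ≤
      min (2 * renyiA 2 ψ) (4 * (n * Real.log 2 - renyiA (1 / 2) ψ)) := by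
    rw [hest]
    refine le_min ?_ ?_
    · refine (stabRenyi_diagState_le_collision hnonneg h0).trans_eq ?_
      rw [renyiA, sum_eigenvalues_rpow ψ hrank two_ne_zero]
      simp only [Real.rpow_two]
      ring
    · have hsum : 0 < ∑ j ∈ Finset.range (2 ^ n), √(lam j) :=
        Finset.sum_pos' (fun _ _ => Real.sqrt_nonneg _)
          ⟨j, Finset.mem_range.mpr (hjr.trans_le hrank), Real.sqrt_pos.mpr hj⟩
      refine (stabRenyi_diagState_le_overlap hsum h0).trans_eq ?_
      rw [renyiA, sum_eigenvalues_rpow ψ hrank (by norm_num)]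
      simp only [← Real.sqrt_eq_rpow]
      ring
  refine ⟨hleast, ?_, hbound, fun hfull => ?_⟩
  · -- both states are the same state of `m + m` qubits, up to qubits in the state `|0⟩`
    obtain ⟨m, hmr, hmA, hmB, hmn⟩ :
        ∃ m, schmidtRank ψ ≤ 2 ^ m ∧ m ≤ nA ∧ m ≤ nB ∧ m ≤ n := by
      refine ⟨min (min nA nB) n, ?_, by omega, by omega, by omega⟩
      rcases min_choice (min nA nB) n with h | h
      · rw [h]
        rcases min_choice nA nB with h' | h' <;> rw [h']
        exacts [schmidtRank_le_left ψ, schmidtRank_le_right ψ]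
      · rwa [h]
    have hzero : ∀ j, 2 ^ m ≤ j → lam j = 0 := fun j h => spectrumSeq_eq_zero ψ (hmr.trans h)
    have hm0 : diagState m m lam ≠ 0 := diagState_ne_zero (hjr.trans_le hmr) hj
    obtain ⟨U, V, hUV⟩ := exists_localAct_eq_diagState ψ
    rw [hest, stabRenyi_diagState hmn hmn hzero hm0, ← stabRenyi_diagState hmA hmB hzero hm0,
      hlam, ← hUV]
    exact hleast.2 ⟨U, V, rfl⟩
  · have hmax : maxEntropyA ψ = n * Real.log 2 := by
      rw [maxEntropyA, hfull, Nat.cast_pow, Real.log_pow, Nat.cast_ofNat]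
    rwa [hmax]
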